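/- **Corollary 2.6.** Let $E$ and $F$ be real Banach lattices with topological duals $E'$, $F'$ (ordered by $f\le g$ iff $f(x)\le g(x)$ for all $x\ge 0$; these are again Banach lattices), and let $T:E\to F$ be a positive bounded linear operator, i.e. $T(E^+)\subset F^+$. Call a sequence $(x_n)$ in a Banach lattice *disjoint* if $|x_n|\wedge|x_m|=0$ for all $n\neq m$. The operator $T$ is called *almost weak Dunford–Pettis* (awDP) if $f_n(Tx_n)\to 0$ for all disjoint sequences $(x_n)\subset E$ and $(f_n)\subset F'$ such that $x_n\to 0$ for $\sigma(E,E')$ and $f_n\to 0$ for $\sigma(F',F'')$. Then the following assertions are equivalent. 1. $T$ is an awDP operator. 2. For all relatively weakly compact subsets $A\subset E$ and $B\subset F'$ and every $\varepsilon>0$ there exists $u\in E^+$ such that $$|f|\bigl(T(|x|-u)^+\bigr)\le\varepsilon\quad\text{for all } x\in A \text{ and all } f\in B.$$ 3. For all relatively weakly compact subsets $A\subset E$ and $B\subset F'$ and every $\varepsilon>0$ there exists $g\in (F')^+$ such that $$(|f|-g)^+\bigl(T|x|\bigr)\le\varepsilon\quad\text{for all } x\in A \text{ and all } f\in B.$$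 Here relatively weakly compact means relatively compact for $\sigma(E,E')$, respectively $\sigma(F',F'')$, and $T(|x|-u)^+$ means $T$ applied to the vector $(|x|-u)^+$. -/

import Mathlib

open Filter Topology

/-! ### The dual Banach lattice

For a normed vector lattice `E`, the topological dual `StrongDual ℝ E` is ordered by
`f ≤ g ↔ ∀ x ≥ 0, f x ≤ g x`. It is a lattice; the supremum is given on the positive cone by
`(f ⊔ g) x = sup {f y + g (x - y) : 0 ≤ y ≤ x}`. -/

namespace DualLattice

section

set_option linter.unusedSectionVars false

variable {E : Type*} [NormedAddCommGroup E] [NormedSpace ℝ E] [Lattice E] [HasSolidNorm E]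
  [IsOrderedAddMonoid E]

instance instPartialOrder : PartialOrder (StrongDual ℝ E) where
  le f g := ∀ x : E, 0 ≤ x → f x ≤ g x
  le_refl _ _ _ := le_rfl
  le_trans _ _ _ h₁ h₂ x hx := (h₁ x hx).trans (h₂ x hx)
  le_antisymm f g h₁ h₂ := by
    ext x
    have key : ∀ y : E, 0 ≤ y → f y = g y := fun y hy => le_antisymm (h₁ y hy) (h₂ y hy)
    rw [← posPart_sub_negPart x, map_sub, map_sub, key _ (posPart_nonneg x),
      key _ (negPart_nonneg x)]

theorem le_def {f g : StrongDual ℝ E} : f ≤ g ↔ ∀ x : E, 0 ≤ x → f x ≤ g x := Iff.rfl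

/-- The set of values `f y + g (x - y)` for `y` in the order interval `[0, x]`. -/
def supSet (f g : StrongDual ℝ E) (x : E) : Set ℝ :=
  (fun y : E => f y + g (x - y)) '' Set.Icc 0 x

theorem abs_le_of_mem_supSet {f g : StrongDual ℝ E} {x : E} {r : ℝ} (hr : r ∈ supSet f g x) :
    |r| ≤ (‖f‖ + ‖g‖) * ‖x‖ := by
  obtain ⟨y, ⟨hy0, hyx⟩, rfl⟩ := hr
  have hx : 0 ≤ x := hy0.trans hyx
  have h1 : ‖y‖ ≤ ‖x‖ := norm_le_norm_of_abs_le_abs (by rwa [abs_of_nonneg hy0, abs_of_nonneg hx])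
  have h2 : ‖x - y‖ ≤ ‖x‖ := norm_le_norm_of_abs_le_abs (by
    rw [abs_of_nonneg (sub_nonneg.2 hyx), abs_of_nonneg hx]
    exact sub_le_self x hy0)
  calc |f y + g (x - y)| ≤ |f y| + |g (x - y)| := abs_add_le _ _
    _ ≤ ‖f‖ * ‖y‖ + ‖g‖ * ‖x - y‖ := add_le_add (f.le_opNorm y) (g.le_opNorm _)
    _ ≤ ‖f‖ * ‖x‖ + ‖g‖ * ‖x‖ := by gcongr
    _ = (‖f‖ + ‖g‖) * ‖x‖ := by ring

theorem bddAbove_supSet (f g : StrongDual ℝ E) (x : E) : BddAbove (supSet f g x) :=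
  ⟨_, fun _ hr => (le_abs_self _).trans (abs_le_of_mem_supSet hr)⟩

theorem nonempty_supSet (f g : StrongDual ℝ E) {x : E} (hx : 0 ≤ x) : (supSet f g x).Nonempty :=
  ⟨_, 0, ⟨le_rfl, hx⟩, rfl⟩

open scoped Pointwise in
theorem supSet_add (f g : StrongDual ℝ E) {a b : E} (ha : 0 ≤ a) (hb : 0 ≤ b) :
    supSet f g (a + b) = supSet f g a + supSet f g b := by
  ext r
  constructor
  · rintro ⟨y, ⟨hy0, hy⟩, rfl⟩
    refine Set.mem_add.2 ⟨_, ⟨y ⊓ a, ⟨le_inf hy0 ha, inf_le_right⟩, rfl⟩, _,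
      ⟨y - y ⊓ a, ⟨sub_nonneg.2 inf_le_left, ?_⟩, rfl⟩, ?_⟩
    · rw [sub_le_iff_le_add, ← sub_le_iff_le_add']
      refine le_inf (sub_le_self y hb) ?_
      rwa [sub_le_iff_le_add]
    · simp only [map_sub, map_add]
      ring
  · intro h
    obtain ⟨_, ⟨y, ⟨hy0, hy⟩, rfl⟩, _, ⟨z, ⟨hz0, hz⟩, rfl⟩, rfl⟩ := Set.mem_add.1 h
    refine ⟨y + z, ⟨add_nonneg hy0 hz0, add_le_add hy hz⟩, ?_⟩
    simp only [map_sub, map_add]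
    ring

theorem sSup_supSet_add (f g : StrongDual ℝ E) {a b : E} (ha : 0 ≤ a) (hb : 0 ≤ b) :
    sSup (supSet f g (a + b)) = sSup (supSet f g a) + sSup (supSet f g b) := by
  rw [supSet_add f g ha hb]
  exact csSup_add (nonempty_supSet f g ha) (bddAbove_supSet f g a) (nonempty_supSet f g hb)
    (bddAbove_supSet f g b)

theorem abs_sSup_supSet_le (f g : StrongDual ℝ E) {x : E} (hx : 0 ≤ x) :
    |sSup (supSet f g x)| ≤ (‖f‖ + ‖g‖) * ‖x‖ := by
  obtain ⟨r, hr⟩ := nonempty_supSet f g hx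
  refine abs_le.2 ⟨?_, csSup_le ⟨r, hr⟩ fun s hs =>
    (le_abs_self s).trans (abs_le_of_mem_supSet hs)⟩
  exact (abs_le.1 (abs_le_of_mem_supSet hr)).1.trans (le_csSup (bddAbove_supSet f g x) hr)

/-- The extension of `x ↦ sSup (supSet f g x)` from the positive cone to an additive map. -/
noncomputable def supHom (f g : StrongDual ℝ E) : E →+ ℝ :=
  AddMonoidHom.mk' (fun x => sSup (supSet f g x⁺) - sSup (supSet f g x⁻)) fun a b => by
    have h : (a + b)⁺ + (a⁻ + b⁻) = (a⁺ + b⁺) + (a + b)⁻ := by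
      have h1 := posPart_sub_negPart (a + b)
      have h2 := posPart_sub_negPart a
      have h3 := posPart_sub_negPart b
      rw [← sub_eq_zero]
      calc (a + b)⁺ + (a⁻ + b⁻) - (a⁺ + b⁺ + (a + b)⁻)
          = ((a + b)⁺ - (a + b)⁻) - (a⁺ - a⁻) - (b⁺ - b⁻) := by abel
        _ = 0 := by rw [h1, h2, h3]; abel
    have h' := congrArg (fun x => sSup (supSet f g x)) h
    rw [sSup_supSet_add f g (posPart_nonneg _) (add_nonneg (negPart_nonneg _) (negPart_nonneg _)),
      sSup_supSet_add f g (negPart_nonneg _) (negPart_nonneg _),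
      sSup_supSet_add f g (add_nonneg (posPart_nonneg _) (posPart_nonneg _)) (negPart_nonneg _),
      sSup_supSet_add f g (posPart_nonneg _) (posPart_nonneg _)] at h'
    linarith

theorem supHom_apply (f g : StrongDual ℝ E) {x : E} (hx : 0 ≤ x) :
    supHom f g x = sSup (supSet f g x) := by
  have h0 : sSup (supSet f g (0 : E)) = 0 := by
    have := sSup_supSet_add f g (le_refl (0 : E)) le_rfl
    rw [add_zero] at this
    linarith
  change sSup (supSet f g x⁺) - sSup (supSet f g x⁻) = _
  rw [posPart_of_nonneg hx, negPart_of_nonneg hx, h0, sub_zero]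

theorem continuous_supHom (f g : StrongDual ℝ E) : Continuous (supHom f g) := by
  refine AddMonoidHomClass.continuous_of_bound (supHom f g) (2 * (‖f‖ + ‖g‖)) fun x => ?_
  have h1 : ‖x⁺‖ ≤ ‖x‖ := norm_le_norm_of_abs_le_abs (by
    rw [abs_of_nonneg (posPart_nonneg x)]
    exact sup_le (le_abs_self x) (abs_nonneg x))
  have h2 : ‖x⁻‖ ≤ ‖x‖ := norm_le_norm_of_abs_le_abs (by
    rw [abs_of_nonneg (negPart_nonneg x)]
    exact sup_le (neg_le_abs x) (abs_nonneg x))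
  change |sSup (supSet f g x⁺) - sSup (supSet f g x⁻)| ≤ _
  calc |sSup (supSet f g x⁺) - sSup (supSet f g x⁻)|
      ≤ |sSup (supSet f g x⁺)| + |sSup (supSet f g x⁻)| := abs_sub _ _
    _ ≤ (‖f‖ + ‖g‖) * ‖x⁺‖ + (‖f‖ + ‖g‖) * ‖x⁻‖ :=
        add_le_add (abs_sSup_supSet_le f g (posPart_nonneg x))
          (abs_sSup_supSet_le f g (negPart_nonneg x))
    _ ≤ (‖f‖ + ‖g‖) * ‖x‖ + (‖f‖ + ‖g‖) * ‖x‖ := by gcongr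
    _ = 2 * (‖f‖ + ‖g‖) * ‖x‖ := by ring

/-- The supremum of two continuous linear functionals. -/
noncomputable def dualSup (f g : StrongDual ℝ E) : StrongDual ℝ E :=
  (supHom f g).toRealLinearMap (continuous_supHom f g)

theorem dualSup_apply (f g : StrongDual ℝ E) {x : E} (hx : 0 ≤ x) :
    dualSup f g x = sSup (supSet f g x) :=
  supHom_apply f g hx

theorem le_dualSup_left (f g : StrongDual ℝ E) : f ≤ dualSup f g := fun x hx => by
  rw [dualSup_apply f g hx]
  exact le_csSup (bddAbove_supSet f g x) ⟨x, ⟨hx, le_rfl⟩, by simp⟩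

theorem le_dualSup_right (f g : StrongDual ℝ E) : g ≤ dualSup f g := fun x hx => by
  rw [dualSup_apply f g hx]
  exact le_csSup (bddAbove_supSet f g x) ⟨0, ⟨le_rfl, hx⟩, by simp⟩

theorem dualSup_le {f g h : StrongDual ℝ E} (hf : f ≤ h) (hg : g ≤ h) : dualSup f g ≤ h :=
  fun x hx => by
    rw [dualSup_apply f g hx]
    refine csSup_le (nonempty_supSet f g hx) ?_
    rintro _ ⟨y, ⟨hy0, hyx⟩, rfl⟩
    have h1 := hf y hy0
    have h2 := hg (x - y) (sub_nonneg.2 hyx)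
    have h3 : h x = h y + h (x - y) := by rw [← map_add, add_sub_cancel]
    linarith

theorem neg_le_neg_dual {f g : StrongDual ℝ E} (h : f ≤ g) : -g ≤ -f :=
  fun x hx => neg_le_neg (h x hx)

noncomputable instance instLattice : Lattice (StrongDual ℝ E) where
  sup := dualSup
  le_sup_left := le_dualSup_left
  le_sup_right := le_dualSup_right
  sup_le _ _ _ := dualSup_le
  inf f g := -dualSup (-f) (-g)
  inf_le_left f g := by simpa using neg_le_neg_dual (le_dualSup_left (-f) (-g))
  inf_le_right f g := by simpa using neg_le_neg_dual (le_dualSup_right (-f) (-g))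
  le_inf f g h hg hh := by
    simpa using neg_le_neg_dual (dualSup_le (neg_le_neg_dual hg) (neg_le_neg_dual hh))

instance instIsOrderedAddMonoid : IsOrderedAddMonoid (StrongDual ℝ E) where
  add_le_add_left _ _ h k x hx := by simpa using h x hx

end

end DualLattice

/-- Disjoint sequences in a vector lattice: `|x n| ⊓ |x m| = 0` for `n ≠ m`. -/
def IsDisjointSeq {E : Type*} [AddCommGroup E] [Lattice E] (x : ℕ → E) : Prop :=
  Pairwise fun n m => |x n| ⊓ |x m| = 0

/-- Weakly null sequences: convergence to `0` in the weak topology `σ(X, X')`. -/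
def IsWeaklyNull {X : Type*} [NormedAddCommGroup X] [NormedSpace ℝ X] (x : ℕ → X) : Prop :=
  Tendsto (fun n => toWeakSpace ℝ X (x n)) atTop (𝓝 0)

/-- Relatively weakly compact sets: the closure for the weak topology is weakly compact. -/
def IsRelWeaklyCompact {X : Type*} [NormedAddCommGroup X] [NormedSpace ℝ X] (A : Set X) : Prop :=
  IsCompact (closure (toWeakSpace ℝ X '' A))

/-- Almost weak Dunford-Pettis operators: `f n (T (x n)) → 0` for all disjoint weakly null
sequences `x` in `E` and `f` in the dual of `F`. -/
def IsAlmostWeakDunfordPettis {E F : Type*}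
    [NormedAddCommGroup E] [NormedSpace ℝ E] [Lattice E]
    [NormedAddCommGroup F] [NormedSpace ℝ F] [Lattice F] [HasSolidNorm F] [IsOrderedAddMonoid F]
    (T : E →L[ℝ] F) : Prop :=
  ∀ (x : ℕ → E) (f : ℕ → StrongDual ℝ F),
    IsWeaklyNull x → IsDisjointSeq x → IsWeaklyNull f → IsDisjointSeq f →
      Tendsto (fun n => f n (T (x n))) atTop (𝓝 0)

/-! ### Weak compactness and weakly absolutely summable sequences of functionals -/

section WeakTopology

variable {X : Type*} [NormedAddCommGroup X] [NormedSpace ℝ X]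

/-! All three assertions concern the positive bilinear form `β x f = f (T x)` on `E × F'`. Assertion
3 is assertion 2 with the two variables exchanged, so one criterion for positive bilinear forms,
`isNullOnDisjointSeqs_iff`, used twice, proves everything.

Two tools carry it. Disjoint sequences in the solid hull of a relatively weakly compact set are
weakly null (`IsRelWeaklyCompact.isWeaklyNull_of_isDisjointSeq`); this rests on a Schur-type
argument by Baire category. And a bounded positive sequence becomes disjoint after subtracting `4 ^
n` times the sum of its earlier terms and `2 ^ (-n)` times a fixed vector
(`exists_isDisjointSeq_posPart_sub`).

If no `u` works for some `ε`, choosing counterexamples recursively against `u = 4 ^ n • ∑ |x i|`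
makes the first correction part of the choice; the second is negligible. This yields disjoint,
weakly null `v n` with `β (v n) |y n|` bounded below. Since `v` is weakly null, a subsequence makes
the corrections needed to disjointify `|y n|` negligible too, contradicting nullity on disjoint
pairs. Conversely, `β |x n| |y n|` is at most `β (|x n| - u)⁺ |y n| + β u |y n|`, whose last term
tends to `0`. -/

theorem isWeaklyNull_iff {x : ℕ → X} :
    IsWeaklyNull x ↔ ∀ f : StrongDual ℝ X, Tendsto (fun n => f (x n)) atTop (𝓝 0) := by
  have hinj : Function.Injective (topDualPairing ℝ X).flip := fun a b h =>
    (SeparatingDual.eq_iff_forall_dual_eq (R := ℝ)).2 fun f => LinearMap.congr_fun h f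
  have h := WeakBilin.tendsto_iff_forall_eval_tendsto (l := atTop) (x := (0 : WeakSpace ℝ X))
    (f := fun n => toWeakSpace ℝ X (x n)) (topDualPairing ℝ X).flip hinj
  refine h.trans (forall_congr' fun f => ?_)
  have h0 : (topDualPairing ℝ X).flip (0 : WeakSpace ℝ X) f = 0 := map_zero f
  rw [h0]
  rfl

theorem continuous_apply_weakSpace (f : StrongDual ℝ X) :
    Continuous fun w : WeakSpace ℝ X => f ((toWeakSpace ℝ X).symm w) :=
  WeakBilin.eval_continuous (topDualPairing ℝ X).flip f

theorem IsWeaklyNull.isRelWeaklyCompact_range {x : ℕ → X} (hx : IsWeaklyNull x) :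
    IsRelWeaklyCompact (Set.range x) := by
  have h := hx.isCompact_insert_range
  refine h.of_isClosed_subset isClosed_closure (closure_minimal ?_ h.isClosed)
  rw [← Set.range_comp]
  exact Set.subset_insert _ _

/-- Uniform boundedness principle, applied to `A` embedded in the bidual. -/
theorem IsRelWeaklyCompact.exists_norm_le {A : Set X} (hA : IsRelWeaklyCompact A) :
    ∃ C, ∀ x ∈ A, ‖x‖ ≤ C := by
  obtain ⟨C, hC⟩ := banach_steinhaus
    (g := fun x : A => NormedSpace.inclusionInDoubleDual ℝ X (x : X)) fun f => by
      obtain ⟨C, hC⟩ := (hA.image (continuous_apply_weakSpace f)).isBounded.exists_norm_le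
      exact ⟨C, fun x => hC _ ⟨toWeakSpace ℝ X x, subset_closure ⟨x, x.2, rfl⟩, rfl⟩⟩
  refine ⟨C, fun x hx => ?_⟩
  have h := hC ⟨x, hx⟩
  exact ((NormedSpace.inclusionInDoubleDualLi ℝ (E := X)).norm_map x).symm.le.trans h

/-- The functional `z ↦ ∑ c n * g n z` for bounded `c` and an absolutely summable family `g`. -/
theorem exists_strongDual_eq_tsum {g : ℕ → StrongDual ℝ X} {C : ℝ}
    (hg : ∀ z N, ∑ n ∈ Finset.range N, |g n z| ≤ C * ‖z‖) (c : ℕ → ℝ) (hc : ∀ n, |c n| ≤ 1) :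
    ∃ h : StrongDual ℝ X, ∀ z, h z = ∑' n, c n * g n z := by
  have hs : ∀ z, Summable fun n => |g n z| := fun z =>
    summable_of_sum_range_le (fun n => abs_nonneg _) (hg z)
  have hle : ∀ z n, ‖c n * g n z‖ ≤ |g n z| := fun z n => by
    rw [Real.norm_eq_abs, abs_mul]
    exact mul_le_of_le_one_left (abs_nonneg _) (hc n)
  have hsc : ∀ z, Summable fun n => c n * g n z := fun z => (hs z).of_norm_bounded (hle z)
  let h : X →ₗ[ℝ] ℝ :=
    { toFun := fun z => ∑' n, c n * g n z
      map_add' := fun z w => by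
        rw [← (hsc z).tsum_add (hsc w)]
        simp only [map_add, mul_add]
      map_smul' := fun r z => by
        simp only [map_smul, smul_eq_mul, RingHom.id_apply]
        rw [← tsum_mul_left]
        exact tsum_congr fun n => by ring }
  exact ⟨h.mkContinuous C fun z => (tsum_of_norm_bounded (hs z).hasSum (hle z)).trans
    (Real.tsum_le_of_sum_range_le (fun n => abs_nonneg _) (hg z)), fun z => rfl⟩

/-- A Schur property, by the Baire category theorem: if all subseries `∑ g n (z k)` tend to `0`
with `k`, then `g n (z k)` is small uniformly in large `n` and `k`. -/
theorem exists_finset_forall_abs_le {b : ℕ → ℕ → ℝ} (hb : ∀ k, Summable fun n => |b k n|)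
    (h : ∀ a : ℕ → Bool, Tendsto (fun k => ∑' n, (if a n then 1 else 0) * b k n) atTop (𝓝 0))
    {ε : ℝ} (hε : 0 < ε) :
    ∃ (I : Finset ℕ) (m : ℕ), ∀ k ≥ m, ∀ n ∉ I, |b k n| ≤ ε := by
  have hle : ∀ k n (a : ℕ → Bool), ‖(if a n then 1 else 0) * b k n‖ ≤ |b k n| := fun k n a => by
    split_ifs <;> simp
  have hcont : ∀ k, Continuous fun a : ℕ → Bool => ∑' n, (if a n then 1 else 0) * b k n :=
    fun k => continuous_tsum (fun n => by
      have : Continuous fun c : Bool => (if c then (1 : ℝ) else 0) * b k n :=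
        continuous_of_discreteTopology
      exact this.comp (continuous_apply n)) (hb k) fun n a => hle k n a
  obtain ⟨m, a₀, ha₀⟩ := nonempty_interior_of_iUnion_of_closed
    (f := fun m : ℕ => ⋂ k ≥ m,
      {a : ℕ → Bool | |∑' n, (if a n then 1 else 0) * b k n| ≤ ε / 2})
    (fun m => isClosed_biInter fun k _ => isClosed_le (hcont k).abs continuous_const) (by
      refine Set.eq_univ_of_forall fun a => Set.mem_iUnion.2 ?_
      have h1 := (h a).abs.eventually_le_const (by rw [abs_zero]; exact half_pos hε)
      obtain ⟨m, hm⟩ := eventually_atTop.1 h1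
      exact ⟨m, Set.mem_iInter₂.2 fun k hk => hm k hk⟩)
  -- A basic neighbourhood of `a₀` restricts only the coordinates in `I`, so any coordinate `n ∉ I`
  -- may be switched freely; the two resulting subseries differ by `b k n`.
  obtain ⟨I, u, hu, hIu⟩ := isOpen_pi_iff.1 isOpen_interior a₀ ha₀
  refine ⟨I, m, fun k hk n hn => ?_⟩
  have key : ∀ c : Bool,
      |∑' i, (if Function.update a₀ n c i then 1 else 0) * b k i| ≤ ε / 2 := fun c => by
    have : Function.update a₀ n c ∈ interior (⋂ k ≥ m,
        {a : ℕ → Bool | |∑' n, (if a n then 1 else 0) * b k n| ≤ ε / 2}) := by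
      refine hIu fun i hi => ?_
      rw [Function.update_of_ne (fun h => hn (by rwa [← h]))]
      exact (hu i hi).2
    exact Set.mem_iInter₂.1 (interior_subset this) k hk
  have hs : ∀ a : ℕ → Bool, Summable fun i => (if a i then 1 else 0) * b k i :=
    fun a => (hb k).of_norm_bounded fun i => hle k i a
  have hdiff : b k n = (∑' i, (if Function.update a₀ n true i then 1 else 0) * b k i)
      - ∑' i, (if Function.update a₀ n false i then 1 else 0) * b k i := by
    rw [← (hs _).tsum_sub (hs _), tsum_eq_single n]
    · simp
    · intro i hi
      simp [Function.update_of_ne hi]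
  rw [hdiff]
  linarith [abs_sub (∑' i, (if Function.update a₀ n true i then 1 else 0) * b k i)
    (∑' i, (if Function.update a₀ n false i then 1 else 0) * b k i), key true, key false]

/-- Along a subsequence, `y` converges to a point `w'` when tested on each subseries sum of `g`. The
Schur property then makes `g n (y k - w')` uniformly small for large `n` and `k`, while `g n w' → 0`
by summability. -/
theorem IsRelWeaklyCompact.tendsto_apply_zero {A : Set X} (hA : IsRelWeaklyCompact A)
    {g : ℕ → StrongDual ℝ X} {C : ℝ} (hg : ∀ z N, ∑ n ∈ Finset.range N, |g n z| ≤ C * ‖z‖)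
    {y : ℕ → X} (hy : ∀ n, y n ∈ A) : Tendsto (fun n => g n (y n)) atTop (𝓝 0) := by
  refine tendsto_of_subseq_tendsto fun ns hns => ?_
  -- The image in the metrizable space `ℕ → ℝ` is sequentially compact, which makes Eberlein–Šmulian
  -- unnecessary.
  let Φ : WeakSpace ℝ X → ℕ → ℝ := fun w n => g n ((toWeakSpace ℝ X).symm w)
  have hΦ : Continuous Φ := continuous_pi fun n => continuous_apply_weakSpace (g n)
  have hyK : ∀ n, toWeakSpace ℝ X (y n) ∈ closure (toWeakSpace ℝ X '' A) :=
    fun n => subset_closure ⟨y n, hy n, rfl⟩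
  obtain ⟨_, ⟨w, hw, rfl⟩, φ, hφ, hlim⟩ := (hA.image hΦ).isSeqCompact
    (x := fun k => Φ (toWeakSpace ℝ X (y (ns k)))) fun k => ⟨_, hyK _, rfl⟩
  refine ⟨φ, ?_⟩
  have hs : ∀ z, Summable fun n => |g n z| := fun z =>
    summable_of_sum_range_le (fun n => abs_nonneg _) (hg z)
  let w' : X := (toWeakSpace ℝ X).symm w
  have hsub : ∀ a : ℕ → Bool, Tendsto (fun k => ∑' n, (if a n then 1 else 0) *
      g n (y (ns (φ k)) - w')) atTop (𝓝 0) := fun a => by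
    obtain ⟨h, hh⟩ := exists_strongDual_eq_tsum hg (fun n => if a n then 1 else 0)
      fun n => by split_ifs <;> simp
    simp only [← hh]
    rw [tendsto_iff_ultrafilter]
    intro U hU
    obtain ⟨v, -, hv⟩ := hA.ultrafilter_le_nhds
      (U.map fun k => toWeakSpace ℝ X (y (ns (φ k))))
      (le_principal_iff.2 (Filter.mem_map.2 (Filter.univ_mem' fun k => hyK (ns (φ k)))))
    have hv : Tendsto (fun k => toWeakSpace ℝ X (y (ns (φ k)))) U (𝓝 v) := hv
    -- The weak limit `v` may depend on the ultrafilter, but `h` sees a point only through `Φ`, so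
    -- `h` takes the same value at `v` and `w`.
    have h1 : Φ v = Φ w := tendsto_nhds_unique ((hΦ.tendsto v).comp hv) (hlim.mono_left hU)
    have h2 := ((continuous_apply_weakSpace h).tendsto v).comp hv
    have h3 : h ((toWeakSpace ℝ X).symm v) = h w' := by
      rw [hh, hh]
      exact tsum_congr fun n => congrArg _ (congrFun h1 n)
    rw [h3] at h2
    simpa using h2.sub_const (h w')
  rw [Metric.tendsto_atTop]
  intro ε hε
  obtain ⟨I, m, hI⟩ := exists_finset_forall_abs_le (b := fun k n => g n (y (ns (φ k)) - w'))
    (fun k => hs _) hsub (half_pos hε)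
  have h1 : Tendsto (fun k => ns (φ k)) atTop atTop := hns.comp hφ.tendsto_atTop
  have h2 : Tendsto (fun n => |g n w'|) atTop (𝓝 0) := (hs w').tendsto_atTop_zero
  have h3 := h1.eventually (h2.eventually (gt_mem_nhds (half_pos hε)))
  have h4 : ∀ᶠ k in atTop, ns (φ k) ∉ I := by
    have h := I.finite_toSet.eventually_cofinite_notMem
    rw [Nat.cofinite_eq_atTop] at h
    exact h1.eventually h
  obtain ⟨N, hN⟩ := eventually_atTop.1 (h3.and (h4.and (eventually_ge_atTop m)))
  refine ⟨N, fun k hk => ?_⟩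
  obtain ⟨h5, h6, h7⟩ := hN k hk
  have h8 := hI k h7 _ h6
  simp only [map_sub] at h8
  rw [Real.dist_eq, sub_zero]
  linarith [abs_sub_abs_le_abs_sub (g (ns (φ k)) (y (ns (φ k)))) (g (ns (φ k)) w')]

end WeakTopology

/-! ### The dual as a normed vector lattice -/

namespace DualLattice

section

variable {E : Type*} [NormedAddCommGroup E] [NormedSpace ℝ E] [Lattice E] [HasSolidNorm E]
  [IsOrderedAddMonoid E]

theorem abs_apply_le (f : StrongDual ℝ E) (x : E) : |f x| ≤ |f| |x| := by
  have h1 : ∀ y : E, 0 ≤ y → |f y| ≤ |f| y := fun y hy =>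
    abs_le'.2 ⟨le_abs_self f y hy, neg_le_abs f y hy⟩
  rw [← posPart_add_negPart x, map_add]
  calc |f x| = |f x⁺ - f x⁻| := by rw [← map_sub, posPart_sub_negPart]
    _ ≤ |f x⁺| + |f x⁻| := abs_sub _ _
    _ ≤ _ := add_le_add (h1 _ (posPart_nonneg x)) (h1 _ (negPart_nonneg x))

/-- `|f| x` is the supremum of `f (y - (x - y))` over `0 ≤ y ≤ x`, and `|y - (x - y)| ≤ x`. -/
theorem abs_apply_le_norm_mul (f : StrongDual ℝ E) {x : E} (hx : 0 ≤ x) :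
    |f| x ≤ ‖f‖ * ‖x‖ := by
  change dualSup f (-f) x ≤ _
  rw [dualSup_apply f (-f) hx]
  refine csSup_le (nonempty_supSet f (-f) hx) ?_
  rintro _ ⟨y, ⟨hy0, hyx⟩, rfl⟩
  have h1 : ‖y - (x - y)‖ ≤ ‖x‖ := norm_le_norm_of_abs_le_abs (by
    rw [abs_of_nonneg hx]
    refine abs_le'.2 ⟨?_, ?_⟩
    · exact (sub_le_self y (sub_nonneg.2 hyx)).trans hyx
    · rw [neg_sub]
      exact (sub_le_self _ hy0).trans (sub_le_self x hy0))
  calc f y + (-f) (x - y) = f (y - (x - y)) := by simp [sub_eq_add_neg]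
    _ ≤ ‖f‖ * ‖y - (x - y)‖ := (le_abs_self _).trans (f.le_opNorm _)
    _ ≤ ‖f‖ * ‖x‖ := by gcongr

instance instHasSolidNorm : HasSolidNorm (StrongDual ℝ E) where
  solid f g h := f.opNorm_le_bound (norm_nonneg g) fun x =>
    (abs_apply_le f x).trans <| (h _ (abs_nonneg x)).trans <| by
      simpa only [norm_abs_eq_norm] using abs_apply_le_norm_mul g (abs_nonneg x)

instance instIsOrderedModule : IsOrderedModule ℝ (StrongDual ℝ E) where
  smul_le_smul_of_nonneg_left _ hc _ _ h x hx := mul_le_mul_of_nonneg_left (h x hx) hc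
  smul_le_smul_of_nonneg_right _ hf _ _ h x hx := mul_le_mul_of_nonneg_right h (hf x hx)

end

end DualLattice

/-! ### Disjointness in vector lattices -/

section VectorLattice

set_option linter.unusedSectionVars false

variable {X : Type*} [AddCommGroup X] [Lattice X] [IsOrderedAddMonoid X]

theorem add_inf_le_inf_add_inf {a b c : X} (ha : 0 ≤ a) (hb : 0 ≤ b) (hc : 0 ≤ c) :
    (a + b) ⊓ c ≤ a ⊓ c + b ⊓ c := by
  rw [add_inf, inf_add, inf_add]
  refine le_inf (le_inf inf_le_left ?_) (le_inf ?_ ?_)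
  · exact inf_le_right.trans (le_add_of_nonneg_right hb)
  · exact inf_le_right.trans (le_add_of_nonneg_left ha)
  · exact inf_le_right.trans (le_add_of_nonneg_right hc)

theorem add_inf_eq_zero {a b c : X} (ha : 0 ≤ a) (hb : 0 ≤ b) (hc : 0 ≤ c)
    (hac : a ⊓ c = 0) (hbc : b ⊓ c = 0) : (a + b) ⊓ c = 0 := by
  refine le_antisymm ?_ (le_inf (add_nonneg ha hb) hc)
  simpa [hac, hbc] using add_inf_le_inf_add_inf ha hb hc

theorem inf_eq_zero_of_le {a b a' b' : X} (ha : 0 ≤ a) (hb : 0 ≤ b) (haa : a ≤ a') (hbb : b ≤ b')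
    (h : a' ⊓ b' = 0) : a ⊓ b = 0 :=
  le_antisymm (h ▸ inf_le_inf haa hbb) (le_inf ha hb)

theorem nsmul_inf_eq_zero {a c : X} (ha : 0 ≤ a) (hc : 0 ≤ c) (h : a ⊓ c = 0) (k : ℕ) :
    (k • a) ⊓ c = 0 := by
  induction k with
  | zero => rw [zero_nsmul]; exact inf_eq_left.2 hc
  | succ k ih =>
    rw [succ_nsmul]
    exact add_inf_eq_zero (nsmul_nonneg ha k) ha hc ih h

theorem sum_inf_eq_zero {ι : Type*} (s : Finset ι) {a : ι → X} {c : X} (ha : ∀ i, 0 ≤ a i)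
    (hc : 0 ≤ c) (h : ∀ i ∈ s, a i ⊓ c = 0) : (∑ i ∈ s, a i) ⊓ c = 0 := by
  classical
  induction s using Finset.induction_on with
  | empty => rw [Finset.sum_empty]; exact inf_eq_left.2 hc
  | insert i s hi ih =>
    rw [Finset.sum_insert hi]
    exact add_inf_eq_zero (ha i) (Finset.sum_nonneg fun j _ => ha j) hc
      (h i (Finset.mem_insert_self i s)) (ih fun j hj => h j (Finset.mem_insert_of_mem hj))

/-- A sum of pairwise disjoint positive vectors is at most any of their common upper bounds. -/
theorem sum_range_le_of_disjoint {a : ℕ → X} {z : X} (hz : 0 ≤ z) (ha : ∀ i, 0 ≤ a i)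
    (hd : Pairwise fun i j => a i ⊓ a j = 0) (hle : ∀ i, a i ≤ z) (N : ℕ) :
    ∑ i ∈ Finset.range N, a i ≤ z := by
  induction N with
  | zero => simpa using hz
  | succ N ih =>
    have h : (∑ i ∈ Finset.range N, a i) ⊓ a N = 0 := sum_inf_eq_zero _ ha (ha N) fun i hi =>
      hd (Finset.mem_range.1 hi).ne
    rw [Finset.sum_range_succ, ← inf_add_sup (∑ i ∈ Finset.range N, a i), h, zero_add]
    exact sup_le ih (hle N)

theorem IsDisjointSeq.abs {x : ℕ → X} (hx : IsDisjointSeq x) : IsDisjointSeq fun n => |x n| := by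
  simpa only [IsDisjointSeq, abs_abs] using hx

theorem IsDisjointSeq.comp_injective {x : ℕ → X} (hx : IsDisjointSeq x) {φ : ℕ → ℕ}
    (hφ : Function.Injective φ) : IsDisjointSeq fun n => x (φ n) :=
  fun _ _ h => hx (hφ.ne h)

/-- Since `t ≥ s⁻¹`, the second term is at most `s⁻¹ • (a - s • b)⁻`, a multiple of the negative
part of the vector whose positive part is the first. -/
theorem posPart_sub_smul_inf_eq_zero [Module ℝ X] [IsOrderedModule ℝ X] {a b : X} {s t : ℝ}
    (hs : 0 < s) (hst : 1 ≤ s * t) (ha : 0 ≤ a) :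
    (a - s • b)⁺ ⊓ (b - t • a)⁺ = 0 := by
  have h1 : (b - t • a)⁺ ≤ s⁻¹ • (a - s • b)⁻ := by
    refine sup_le ?_ (smul_nonneg (inv_nonneg.2 hs.le) (negPart_nonneg _))
    calc b - t • a ≤ b - s⁻¹ • a := by
          refine sub_le_sub_left (smul_le_smul_of_nonneg_right ?_ ha) b
          rwa [inv_le_iff_one_le_mul₀' hs]
      _ = s⁻¹ • -(a - s • b) := by
          rw [neg_sub, smul_sub, smul_smul, inv_mul_cancel₀ hs.ne', one_smul]
      _ ≤ s⁻¹ • (a - s • b)⁻ :=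
          smul_le_smul_of_nonneg_left (neg_le_negPart _) (inv_nonneg.2 hs.le)
  obtain ⟨k, hk⟩ := exists_nat_ge s⁻¹
  have h2 : (b - t • a)⁺ ≤ k • (a - s • b)⁻ := h1.trans <| by
    rw [← Nat.cast_smul_eq_nsmul ℝ]
    exact smul_le_smul_of_nonneg_right hk (negPart_nonneg _)
  refine inf_eq_zero_of_le (posPart_nonneg _) (posPart_nonneg _) le_rfl h2 ?_
  rw [inf_comm]
  exact nsmul_inf_eq_zero (negPart_nonneg _) (posPart_nonneg _)
    ((inf_comm _ _).trans (posPart_inf_negPart_eq_zero _)) k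

end VectorLattice

/-! ### Disjoint sequences in solid hulls -/

section SolidHull

set_option linter.unusedSectionVars false

open DualLattice

variable {X : Type*} [NormedAddCommGroup X] [NormedSpace ℝ X] [Lattice X] [HasSolidNorm X]
  [IsOrderedAddMonoid X] [IsOrderedModule ℝ X]

/-- The value at `|z|` of the component of the positive functional `f` in the band of `x`. -/
noncomputable def componentSeminorm (f : StrongDual ℝ X) (x z : X) : ℝ :=
  ⨆ k : ℕ, f (|z| ⊓ k • x)

section

variable {f : StrongDual ℝ X} {x : X}

theorem apply_mono (hf : 0 ≤ f) : Monotone f := fun a b h => by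
  have h1 : 0 ≤ f (b - a) := hf (b - a) (sub_nonneg.2 h)
  rwa [map_sub, sub_nonneg] at h1

theorem bddAbove_range_component (hf : 0 ≤ f) (z : X) :
    BddAbove (Set.range fun k : ℕ => f (|z| ⊓ k • x)) :=
  ⟨f |z|, by rintro _ ⟨k, rfl⟩; exact apply_mono hf inf_le_left⟩

theorem tendsto_componentSeminorm (hf : 0 ≤ f) (hx : 0 ≤ x) (z : X) :
    Tendsto (fun k : ℕ => f (|z| ⊓ k • x)) atTop (𝓝 (componentSeminorm f x z)) :=
  tendsto_atTop_ciSup (fun _ _ h => apply_mono hf (inf_le_inf_left _ (nsmul_le_nsmul_left hx h)))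
    (bddAbove_range_component hf z)

theorem componentSeminorm_neg (z : X) :
    componentSeminorm f x (-z) = componentSeminorm f x z := by
  simp [componentSeminorm]

theorem componentSeminorm_add_le (hf : 0 ≤ f) (hx : 0 ≤ x) (z w : X) :
    componentSeminorm f x (z + w) ≤ componentSeminorm f x z + componentSeminorm f x w := by
  refine ciSup_le fun k => ?_
  calc f (|z + w| ⊓ k • x) ≤ f (|z| ⊓ k • x + |w| ⊓ k • x) :=
        apply_mono hf ((inf_le_inf_right _ (abs_add_le z w)).trans
          (add_inf_le_inf_add_inf (abs_nonneg z) (abs_nonneg w) (nsmul_nonneg hx k)))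
    _ ≤ _ := by
        rw [map_add]
        exact add_le_add (le_ciSup (bddAbove_range_component hf z) k)
          (le_ciSup (bddAbove_range_component hf w) k)

theorem componentSeminorm_smul_le (hf : 0 ≤ f) (hx : 0 ≤ x) {c : ℝ} (hc : 0 < c) (z : X) :
    componentSeminorm f x (c • z) ≤ c * componentSeminorm f x z := by
  refine ciSup_le fun k => ?_
  -- Dividing by `c` turns the cutoff `k • x` into `(c⁻¹ * k) • x`; rounding up keeps it in the
  -- supremum.
  obtain ⟨j, hj⟩ := exists_nat_ge (c⁻¹ * k)
  have h : |c • z| ⊓ k • x ≤ c • (|z| ⊓ j • x) := by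
    rw [← inv_smul_le_iff_of_pos hc]
    refine le_inf ?_ ?_
    · rw [inv_smul_le_iff_of_pos hc]
      refine inf_le_left.trans (abs_le'.2 ⟨?_, ?_⟩)
      · exact smul_le_smul_of_nonneg_left (le_abs_self z) hc.le
      · rw [← smul_neg]
        exact smul_le_smul_of_nonneg_left (neg_le_abs z) hc.le
    · refine (smul_le_smul_of_nonneg_left inf_le_right (inv_nonneg.2 hc.le)).trans ?_
      rw [← Nat.cast_smul_eq_nsmul ℝ, ← Nat.cast_smul_eq_nsmul ℝ, smul_smul]
      exact smul_le_smul_of_nonneg_right hj hx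
  refine (apply_mono hf h).trans ?_
  rw [map_smul, smul_eq_mul]
  exact mul_le_mul_of_nonneg_left (le_ciSup (bddAbove_range_component hf z) j) hc.le

theorem componentSeminorm_smul (hf : 0 ≤ f) (hx : 0 ≤ x) {c : ℝ} (hc : 0 < c) (z : X) :
    componentSeminorm f x (c • z) = c * componentSeminorm f x z := by
  refine le_antisymm (componentSeminorm_smul_le hf hx hc z) ?_
  have h := componentSeminorm_smul_le hf hx (inv_pos.2 hc) (c • z)
  rwa [smul_smul, inv_mul_cancel₀ hc.ne', one_smul, ← div_eq_inv_mul, le_div_iff₀' hc] at h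

theorem componentSeminorm_le (hf : 0 ≤ f) (z : X) : componentSeminorm f x z ≤ ‖f‖ * ‖z‖ :=
  ciSup_le fun _ => (apply_mono hf inf_le_left).trans <| (Real.le_norm_self _).trans <| by
    simpa only [norm_abs_eq_norm] using f.le_opNorm |z|

theorem apply_le_componentSeminorm (hf : 0 ≤ f) {z : X} (hxz : x ≤ |z|) :
    f x ≤ componentSeminorm f x z := by
  have h := le_ciSup (bddAbove_range_component (x := x) hf z) 1
  rwa [one_nsmul, inf_eq_right.2 hxz] at h

/-- Hahn–Banach from the line through `y`. It linearizes the component at one vector without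
constructing band projections. -/
theorem exists_strongDual_le_componentSeminorm (hf : 0 ≤ f) (hx : 0 ≤ x) (y : X) :
    ∃ g : StrongDual ℝ X, (∀ z, |g z| ≤ componentSeminorm f x z) ∧
      g y = componentSeminorm f x y := by
  have h0 : componentSeminorm f x 0 = 0 := by
    simp [componentSeminorm, inf_eq_left.2 (nsmul_nonneg hx _)]
  have hy0 : 0 ≤ componentSeminorm f x y := by
    have h := componentSeminorm_add_le hf hx y (-y)
    rw [add_neg_cancel, h0, componentSeminorm_neg] at h
    linarith
  obtain ⟨g, hg, hle⟩ : ∃ g : X →ₗ[ℝ] ℝ, g y = componentSeminorm f x y ∧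
      ∀ z, g z ≤ componentSeminorm f x z := by
    rcases eq_or_ne y 0 with rfl | hy
    · obtain ⟨g, -, hle⟩ := exists_extension_of_le_sublinear ⊥ (componentSeminorm f x)
        (fun c hc z => componentSeminorm_smul hf hx hc z) (componentSeminorm_add_le hf hx)
        (fun z => by
          obtain ⟨z, hz⟩ := z
          obtain rfl := (Submodule.mem_bot ℝ).1 hz
          rw [h0]
          exact (map_zero _).le)
      exact ⟨g, by rw [map_zero, h0], hle⟩
    · obtain ⟨g, hg, hle⟩ := exists_extension_of_le_sublinear
        (LinearPMap.mkSpanSingleton y (componentSeminorm f x y) hy) (componentSeminorm f x)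
        (fun c hc z => componentSeminorm_smul hf hx hc z) (componentSeminorm_add_le hf hx)
        (fun z => by
          obtain ⟨z, hz⟩ := z
          obtain ⟨c, rfl⟩ := Submodule.mem_span_singleton.1 hz
          have hval : LinearPMap.mkSpanSingleton y (componentSeminorm f x y) hy ⟨c • y, hz⟩ =
              c * componentSeminorm f x y := LinearPMap.mkSpanSingleton'_apply _ _ _ _ _
          rw [hval]
          rcases lt_trichotomy c 0 with hc | rfl | hc
          · have h := componentSeminorm_smul hf hx (neg_pos.2 hc) y
            rw [neg_smul, componentSeminorm_neg] at h
            rw [h]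
            nlinarith
          · simp [h0]
          · rw [componentSeminorm_smul hf hx hc])
      exact ⟨g, (hg ⟨y, Submodule.mem_span_singleton_self y⟩).trans
        (LinearPMap.mkSpanSingleton_apply ℝ ℝ hy _), hle⟩
  have habs : ∀ z, |g z| ≤ componentSeminorm f x z := fun z => abs_le'.2 ⟨hle z, by
    rw [← map_neg, ← componentSeminorm_neg]; exact hle _⟩
  exact ⟨g.mkContinuous ‖f‖ fun z => (habs z).trans (componentSeminorm_le hf z), habs, hg⟩

end

/-- For each `k` the vectors `|z| ⊓ k • x n` are pairwise disjoint and below `|z|`, hence so is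
their sum; then `k → ∞`. -/
theorem sum_componentSeminorm_le {f : StrongDual ℝ X} (hf : 0 ≤ f) {x : ℕ → X}
    (hx : ∀ n, 0 ≤ x n) (hd : IsDisjointSeq x) (z : X) (N : ℕ) :
    ∑ n ∈ Finset.range N, componentSeminorm f (x n) z ≤ ‖f‖ * ‖z‖ := by
  refine le_of_tendsto (tendsto_finsetSum _ fun n _ => tendsto_componentSeminorm hf (hx n) z)
    (Eventually.of_forall fun k => ?_)
  rw [← map_sum]
  have h0 : ∀ n, 0 ≤ k • x n := fun n => nsmul_nonneg (hx n) k
  have h : ∑ n ∈ Finset.range N, |z| ⊓ k • x n ≤ |z| :=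
    sum_range_le_of_disjoint (abs_nonneg z) (fun n => le_inf (abs_nonneg z) (h0 n))
      (fun n m hnm => by
        have hnm : |x n| ⊓ |x m| = 0 := hd hnm
        rw [abs_of_nonneg (hx n), abs_of_nonneg (hx m)] at hnm
        refine inf_eq_zero_of_le (le_inf (abs_nonneg z) (h0 n)) (le_inf (abs_nonneg z) (h0 m))
          inf_le_right inf_le_right (nsmul_inf_eq_zero (hx n) (h0 m) ?_ k)
        rw [inf_comm] at hnm ⊢
        exact nsmul_inf_eq_zero (hx m) (hx n) hnm k)
      (fun n => inf_le_left) N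
  refine (apply_mono hf h).trans ((Real.le_norm_self _).trans ?_)
  simpa only [norm_abs_eq_norm] using f.le_opNorm |z|

/-- Disjoint sequences in the solid hull of a relatively weakly compact set are weakly null. -/
theorem IsRelWeaklyCompact.isWeaklyNull_of_isDisjointSeq {A : Set X} (hA : IsRelWeaklyCompact A)
    {x : ℕ → X} (hd : IsDisjointSeq x) (hx : ∀ n, ∃ y ∈ A, |x n| ≤ |y|) : IsWeaklyNull x := by
  choose y hyA hxy using hx
  refine isWeaklyNull_iff.2 fun f => ?_
  have hf : 0 ≤ |f| := abs_nonneg f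
  choose g hg hgy using fun n =>
    exists_strongDual_le_componentSeminorm hf (abs_nonneg (x n)) (y n)
  have h := hA.tendsto_apply_zero (g := g) (C := ‖|f|‖) (fun z N =>
    (Finset.sum_le_sum fun n _ => hg n z).trans
      (sum_componentSeminorm_le hf (fun n => abs_nonneg (x n)) hd.abs z N)) hyA
  refine squeeze_zero_norm (fun n => (abs_apply_le f (x n)).trans ?_) h
  rw [hgy]
  exact apply_le_componentSeminorm hf (hxy n)

end SolidHull

/-! ### Making bounded sequences disjoint -/

section Disjointification

set_option linter.unusedSectionVars false

variable {X : Type*} [NormedAddCommGroup X] [NormedSpace ℝ X] [Lattice X] [HasSolidNorm X]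
  [IsOrderedAddMonoid X] [IsOrderedModule ℝ X]

theorem posPart_le_posPart_sub_add (a : X) {c : X} (hc : 0 ≤ c) : a⁺ ≤ (a - c)⁺ + c :=
  sup_le (sub_le_iff_le_add.1 (le_posPart _)) (add_nonneg (posPart_nonneg _) hc)

/-- Every norm bounded positive sequence can be made disjoint by subtracting large multiples of
its earlier terms and small multiples of a fixed vector. -/
theorem exists_isDisjointSeq_posPart_sub [CompleteSpace X] {x : ℕ → X} (hx : ∀ n, 0 ≤ x n) {C : ℝ}
    (hC : ∀ n, ‖x n‖ ≤ C) :
    ∃ s : X, 0 ≤ s ∧ IsDisjointSeq fun n =>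
      (x (n + 1) - (4 : ℝ) ^ n • ∑ i ∈ Finset.range (n + 1), x i - (1 / 2 : ℝ) ^ n • s)⁺ := by
  have hpow : ∀ n : ℕ, (0 : ℝ) ≤ (1 / 2) ^ n := fun n => by positivity
  have hterm : ∀ n, 0 ≤ (1 / 2 : ℝ) ^ n • x n := fun n => smul_nonneg (hpow n) (hx n)
  have hs : Summable fun n => (1 / 2 : ℝ) ^ n • x n :=
    (summable_geometric_two.mul_right C).of_norm_bounded fun n => by
      rw [norm_smul, Real.norm_of_nonneg (hpow n)]
      exact mul_le_mul_of_nonneg_left (hC n) (hpow n)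
  refine ⟨∑' n, (1 / 2 : ℝ) ^ n • x n, tsum_nonneg hterm, ?_⟩
  set s := ∑' n, (1 / 2 : ℝ) ^ n • x n
  have hle : ∀ n, (1 / 2 : ℝ) ^ n • x n ≤ s := fun n => hs.le_tsum n fun i _ => hterm i
  have hs0 : 0 ≤ s := tsum_nonneg hterm
  have key : ∀ n m, n < m →
      (x (n + 1) - (4 : ℝ) ^ n • ∑ i ∈ Finset.range (n + 1), x i - (1 / 2 : ℝ) ^ n • s)⁺ ⊓
      (x (m + 1) - (4 : ℝ) ^ m • ∑ i ∈ Finset.range (m + 1), x i - (1 / 2 : ℝ) ^ m • s)⁺ = 0 := by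
    intro n m hnm
    -- The product is `2 ^ (m - n - 1)`. The first factor arises from `2 ^ (-n) • s ≥ 2 ^ (-(n + m +
    -- 1)) • x (m + 1)`.
    have hone : 1 ≤ (1 / 2 : ℝ) ^ (n + (m + 1)) * 4 ^ m := by
      have h4 : (4 : ℝ) ^ m = 2 ^ (2 * m) := by rw [pow_mul]; norm_num
      rw [h4, one_div, inv_pow, ← div_eq_inv_mul, one_le_div (by positivity)]
      exact pow_le_pow_right₀ one_le_two (by omega)
    refine inf_eq_zero_of_le (posPart_nonneg _) (posPart_nonneg _) (posPart_mono ?_)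
      (posPart_mono ?_)
      (posPart_sub_smul_inf_eq_zero (a := x (n + 1)) (b := x (m + 1)) (by positivity) hone (hx _))
    · refine sub_le_sub ?_ ?_
      · exact sub_le_self _ (smul_nonneg (by positivity) (Finset.sum_nonneg fun i _ => hx i))
      · rw [pow_add, mul_smul]
        exact smul_le_smul_of_nonneg_left (hle _) (hpow n)
    · refine (sub_le_self _ (smul_nonneg (hpow m) hs0)).trans (sub_le_sub_left ?_ _)
      exact smul_le_smul_of_nonneg_left
        (Finset.single_le_sum (fun i _ => hx i) (Finset.mem_range.2 (by omega))) (by positivity)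
  intro n m hnm
  simp only [abs_of_nonneg (posPart_nonneg _)]
  rcases hnm.lt_or_gt with h | h
  · exact key n m h
  · rw [inf_comm]
    exact key m n h

end Disjointification

/-! ### The criterion for positive bilinear forms -/

section BilinearForm

set_option linter.unusedSectionVars false

variable {X Y : Type*} [NormedAddCommGroup X] [NormedSpace ℝ X] [Lattice X] [HasSolidNorm X]
  [IsOrderedAddMonoid X] [IsOrderedModule ℝ X] [CompleteSpace X]
  [NormedAddCommGroup Y] [NormedSpace ℝ Y] [Lattice Y] [HasSolidNorm Y]
  [IsOrderedAddMonoid Y] [IsOrderedModule ℝ Y] [CompleteSpace Y]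

/-- Bilinear forms tending to `0` along pairs of disjoint weakly null sequences. -/
def IsNullOnDisjointSeqs (β : X →L[ℝ] Y →L[ℝ] ℝ) : Prop :=
  ∀ (x : ℕ → X) (y : ℕ → Y), IsWeaklyNull x → IsDisjointSeq x → IsWeaklyNull y →
    IsDisjointSeq y → Tendsto (fun n => β (x n) (y n)) atTop (𝓝 0)

variable {β : X →L[ℝ] Y →L[ℝ] ℝ}

theorem apply_apply_mono_left (hβ : ∀ x y, 0 ≤ x → 0 ≤ y → 0 ≤ β x y) {a b : X} (h : a ≤ b) {y : Y}
    (hy : 0 ≤ y) : β a y ≤ β b y := by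
  have h1 := hβ (b - a) y (sub_nonneg.2 h) hy
  rw [map_sub, sub_apply] at h1
  linarith

theorem apply_apply_mono_right (hβ : ∀ x y, 0 ≤ x → 0 ≤ y → 0 ≤ β x y) {x : X} (hx : 0 ≤ x)
    {a b : Y} (h : a ≤ b) : β x a ≤ β x b := by
  have h1 := hβ x (b - a) hx (sub_nonneg.2 h)
  rw [map_sub] at h1
  linarith

/-- Expand `β (|x| ± x) (|y| ± y) ≥ 0` and add in pairs: opposite signs bound `β x y`, equal signs
bound `-β x y`. -/
theorem abs_apply_apply_le (hβ : ∀ x y, 0 ≤ x → 0 ≤ y → 0 ≤ β x y) (x : X) (y : Y) :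
    |β x y| ≤ β |x| |y| := by
  have hx1 : 0 ≤ |x| - x := sub_nonneg.2 (le_abs_self x)
  have hx2 : 0 ≤ |x| + x := sub_neg_eq_add |x| x ▸ sub_nonneg.2 (neg_le_abs x)
  have hy1 : 0 ≤ |y| - y := sub_nonneg.2 (le_abs_self y)
  have hy2 : 0 ≤ |y| + y := sub_neg_eq_add |y| y ▸ sub_nonneg.2 (neg_le_abs y)
  have h1 := hβ _ _ hx1 hy2
  have h2 := hβ _ _ hx2 hy1
  have h3 := hβ _ _ hx1 hy1
  have h4 := hβ _ _ hx2 hy2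
  simp only [map_sub, map_add, sub_apply, add_apply] at h1 h2 h3 h4
  exact abs_le'.2 ⟨by linarith, by linarith⟩

theorem IsWeaklyNull.comp_strictMono {X : Type*} [NormedAddCommGroup X] [NormedSpace ℝ X]
    {x : ℕ → X} (hx : IsWeaklyNull x) {φ : ℕ → ℕ} (hφ : StrictMono φ) :
    IsWeaklyNull fun n => x (φ n) :=
  Tendsto.comp (g := fun n => toWeakSpace ℝ X (x n)) hx hφ.tendsto_atTop

/-- A subsequence along which `β (v (φ (n + 1)))` is small on the earlier `y (φ i)`. -/
theorem exists_strictMono_mul_sum_le (hβ : ∀ x y, 0 ≤ x → 0 ≤ y → 0 ≤ β x y) {v : ℕ → X}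
    (hv0 : ∀ n, 0 ≤ v n) (hv : IsWeaklyNull v) {y : ℕ → Y} (hy : ∀ n, 0 ≤ y n) :
    ∃ φ : ℕ → ℕ, StrictMono φ ∧ ∀ n,
      (4 : ℝ) ^ n * β (v (φ (n + 1))) (∑ i ∈ Finset.range (n + 1), y (φ i)) ≤ (1 / 2) ^ n := by
  have h : ∀ n N : ℕ, ∃ k, N < k ∧
      (4 : ℝ) ^ n * β (v k) (∑ i ∈ Finset.range (N + 1), y i) ≤ (1 / 2) ^ n := fun n N => by
    have h1 := ((isWeaklyNull_iff.1 hv (β.flip (∑ i ∈ Finset.range (N + 1), y i))).const_mul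
      ((4 : ℝ) ^ n)).eventually_le_const (u := (1 / 2) ^ n) (by rw [mul_zero]; positivity)
    obtain ⟨k, hk1, hk2⟩ := (h1.and (eventually_gt_atTop N)).exists
    exact ⟨k, hk2, hk1⟩
  choose F hF1 hF2 using h
  -- `F n N` controls the sum over all indices up to `N`; with `N = φ n` this includes `φ 0, …, φ
  -- n`.
  let φ : ℕ → ℕ := fun n => Nat.rec 0 F n
  have hφ : StrictMono φ := strictMono_nat_of_lt_succ fun n => hF1 n (φ n)
  refine ⟨φ, hφ, fun n => le_trans ?_ (hF2 n (φ n))⟩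
  refine mul_le_mul_of_nonneg_left (apply_apply_mono_right hβ (hv0 _) ?_) (by positivity)
  rw [← Finset.sum_image (f := y) (s := Finset.range (n + 1)) (g := φ)
    fun a _ b _ hab => hφ.injective hab]
  refine Finset.sum_le_sum_of_subset_of_nonneg ?_ fun i _ _ => hy i
  intro j hj
  obtain ⟨i, hi, rfl⟩ := Finset.mem_image.1 hj
  exact Finset.mem_range.2 (Nat.lt_succ_of_le (hφ.monotone
    (Nat.le_of_lt_succ (Finset.mem_range.1 hi))))

/-- Only the second sequence remains to be disjointified: weak nullity of `v` makes the subtracted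
earlier terms negligible, and the multiple of `s` vanishes as well. -/
theorem IsNullOnDisjointSeqs.not_forall_le (hnull : IsNullOnDisjointSeqs β)
    (hβ : ∀ x y, 0 ≤ x → 0 ≤ y → 0 ≤ β x y) {v : ℕ → X} (hv0 : ∀ n, 0 ≤ v n)
    (hv : IsWeaklyNull v) (hvd : IsDisjointSeq v) {B : Set Y} (hB : IsRelWeaklyCompact B)
    {y : ℕ → Y} (hy : ∀ n, y n ∈ B) {δ : ℝ} (hδ : 0 < δ) : ¬ ∀ n, δ ≤ β (v n) |y n| := by
  intro hle
  obtain ⟨φ, hφ, hsum⟩ := exists_strictMono_mul_sum_le hβ hv0 hv fun n => abs_nonneg (y n)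
  obtain ⟨C, hC⟩ := hB.exists_norm_le
  obtain ⟨s, hs0, hd⟩ := exists_isDisjointSeq_posPart_sub (x := fun n => |y (φ n)|)
    (fun n => abs_nonneg _) (C := C) fun n => by
      rw [norm_abs_eq_norm]
      exact hC _ (hy _)
  set w : ℕ → Y := fun n => (|y (φ (n + 1))| -
    (4 : ℝ) ^ n • ∑ i ∈ Finset.range (n + 1), |y (φ i)| - (1 / 2 : ℝ) ^ n • s)⁺
  have hφ1 : StrictMono fun n => φ (n + 1) := fun a b hab => hφ (Nat.succ_lt_succ hab)
  have hw : IsWeaklyNull w := hB.isWeaklyNull_of_isDisjointSeq hd fun n =>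
    ⟨y (φ (n + 1)), hy _, by
      rw [abs_of_nonneg (posPart_nonneg _)]
      refine sup_le ?_ (abs_nonneg _)
      refine (sub_le_self _ (smul_nonneg (by positivity) hs0)).trans (sub_le_self _ ?_)
      exact smul_nonneg (by positivity) (Finset.sum_nonneg fun i _ => abs_nonneg _)⟩
  have hv' := hv.comp_strictMono hφ1
  have h1 := hnull _ w hv' (hvd.comp_injective hφ1.injective) hw hd
  have hhalf : Tendsto (fun n : ℕ => (1 / 2 : ℝ) ^ n) atTop (𝓝 0) :=
    tendsto_pow_atTop_nhds_zero_of_lt_one (by norm_num) (by norm_num)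
  have h2 := (h1.add hhalf).add (hhalf.mul (isWeaklyNull_iff.1 hv' (β.flip s)))
  simp only [add_zero, mul_zero] at h2
  obtain ⟨n, hn⟩ := (h2.eventually_lt_const hδ).exists
  have h3 : |y (φ (n + 1))| ≤ w n + (4 : ℝ) ^ n • ∑ i ∈ Finset.range (n + 1), |y (φ i)| +
      (1 / 2 : ℝ) ^ n • s := by
    rw [add_right_comm, ← sub_le_iff_le_add, ← sub_le_iff_le_add]
    exact le_posPart _
  have h4 := apply_apply_mono_right hβ (hv0 (φ (n + 1))) h3
  simp only [map_add, map_smul, smul_eq_mul] at h4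
  have h5 : β.flip s (v (φ (n + 1))) = β (v (φ (n + 1))) s := rfl
  rw [h5] at hn
  have h6 := hsum n
  have h7 := hle (φ (n + 1))
  linarith

theorem IsNullOnDisjointSeqs.exists_forall_apply_posPart_sub_le (hnull : IsNullOnDisjointSeqs β)
    (hβ : ∀ x y, 0 ≤ x → 0 ≤ y → 0 ≤ β x y) {A : Set X} (hA : IsRelWeaklyCompact A)
    {B : Set Y} (hB : IsRelWeaklyCompact B) {ε : ℝ} (hε : 0 < ε) :
    ∃ u : X, 0 ≤ u ∧ ∀ x ∈ A, ∀ y ∈ B, β (|x| - u)⁺ |y| ≤ ε := by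
  by_contra! hcon
  choose a ha b hb hab using fun u : X => hcon |u| (abs_nonneg u)
  -- `S n` is the sum of `|x i|` for `i ≤ n`; the counterexample to `u = 4 ^ n • S n` supplies `x (n
  -- + 1)` and its partner `y n`.
  let S : ℕ → X := fun n => Nat.rec |a 0| (fun n S => S + |a ((4 : ℝ) ^ n • S)|) n
  let x : ℕ → X := fun n => Nat.casesOn n (a 0) fun n => a ((4 : ℝ) ^ n • S n)
  have hS : ∀ n, ∑ i ∈ Finset.range (n + 1), |x i| = S n := fun n => by
    induction n with
    | zero => simp [x, S]
    | succ n ih => rw [Finset.sum_range_succ, ih]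
  have hS0 : ∀ n, 0 ≤ S n := fun n => hS n ▸ Finset.sum_nonneg fun i _ => abs_nonneg _
  have hxA : ∀ n, x n ∈ A := fun n => by cases n <;> exact ha _
  let y : ℕ → Y := fun n => b ((4 : ℝ) ^ n • S n)
  have hxy : ∀ n, ε < β (|x (n + 1)| - (4 : ℝ) ^ n • S n)⁺ |y n| := fun n => by
    have h := hab ((4 : ℝ) ^ n • S n)
    rwa [abs_of_nonneg (smul_nonneg (by positivity) (hS0 n))] at h
  obtain ⟨C, hC⟩ := hA.exists_norm_le
  obtain ⟨D, hD⟩ := hB.exists_norm_le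
  obtain ⟨s, hs0, hd⟩ := exists_isDisjointSeq_posPart_sub (x := fun n => |x n|)
    (fun n => abs_nonneg _) (C := C) fun n => by
      rw [norm_abs_eq_norm]
      exact hC _ (hxA _)
  simp only [hS] at hd
  set v : ℕ → X := fun n => (|x (n + 1)| - (4 : ℝ) ^ n • S n - (1 / 2 : ℝ) ^ n • s)⁺
  have hv : IsWeaklyNull v := hA.isWeaklyNull_of_isDisjointSeq hd fun n =>
    ⟨x (n + 1), hxA (n + 1), by
      rw [abs_of_nonneg (posPart_nonneg _)]
      refine sup_le ?_ (abs_nonneg _)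
      refine (sub_le_self _ (smul_nonneg (by positivity) hs0)).trans (sub_le_self _ ?_)
      exact smul_nonneg (by positivity) (hS0 n)⟩
  have hhalf : Tendsto (fun n : ℕ => (1 / 2 : ℝ) ^ n * (‖β s‖ * D)) atTop (𝓝 0) := by
    simpa using (tendsto_pow_atTop_nhds_zero_of_lt_one (r := (1 / 2 : ℝ)) (by norm_num)
      (by norm_num)).mul_const (‖β s‖ * D)
  -- From `N` on, subtracting `2 ^ (-n) • s` costs at most `ε / 2`, so half of the lower bound
  -- survives.
  obtain ⟨N, hN⟩ := eventually_atTop.1 (hhalf.eventually_le_const (half_pos hε))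
  have hshift : StrictMono fun n => n + N := fun _ _ h => Nat.add_lt_add_right h N
  refine hnull.not_forall_le hβ (v := fun n => v (n + N)) (fun n => posPart_nonneg _)
    (hv.comp_strictMono hshift) (hd.comp_injective hshift.injective) hB
    (y := fun n => y (n + N)) (fun n => hb _) (half_pos hε) fun n => ?_
  have hc : 0 ≤ (1 / 2 : ℝ) ^ (n + N) • s := smul_nonneg (by positivity) hs0
  have h1 := posPart_le_posPart_sub_add (|x (n + N + 1)| - (4 : ℝ) ^ (n + N) • S (n + N)) hc
  have h2 := apply_apply_mono_left hβ h1 (abs_nonneg (y (n + N)))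
  rw [map_add, map_smul, add_apply, smul_apply, smul_eq_mul] at h2
  have h3 : β s |y (n + N)| ≤ ‖β s‖ * D := by
    refine (Real.le_norm_self _).trans (((β s).le_opNorm _).trans ?_)
    rw [norm_abs_eq_norm]
    exact mul_le_mul_of_nonneg_left (hD _ (hb _)) (norm_nonneg _)
  have h4 := mul_le_mul_of_nonneg_left h3 (by positivity : (0 : ℝ) ≤ (1 / 2) ^ (n + N))
  have h5 := hN (n + N) (Nat.le_add_left _ _)
  have h6 := hxy (n + N)
  linarith

theorem isNullOnDisjointSeqs_of_forall_exists (hβ : ∀ x y, 0 ≤ x → 0 ≤ y → 0 ≤ β x y)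
    (h : ∀ (A : Set X) (B : Set Y), IsRelWeaklyCompact A → IsRelWeaklyCompact B →
      ∀ ε : ℝ, 0 < ε → ∃ u : X, 0 ≤ u ∧ ∀ x ∈ A, ∀ y ∈ B, β (|x| - u)⁺ |y| ≤ ε) :
    IsNullOnDisjointSeqs β := by
  intro x y hx _ hy hyd
  have hB := hy.isRelWeaklyCompact_range
  have hyabs : IsWeaklyNull fun n => |y n| :=
    hB.isWeaklyNull_of_isDisjointSeq hyd.abs fun n => ⟨y n, ⟨n, rfl⟩, (abs_abs _).le⟩
  rw [Metric.tendsto_atTop]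
  intro ε hε
  obtain ⟨u, hu0, hu⟩ := h _ _ hx.isRelWeaklyCompact_range hB (ε / 2) (half_pos hε)
  obtain ⟨N, hN⟩ := eventually_atTop.1
    ((isWeaklyNull_iff.1 hyabs (β u)).eventually_lt_const (half_pos hε))
  refine ⟨N, fun n hn => ?_⟩
  rw [Real.dist_eq, sub_zero]
  have h1 : |x n| ≤ (|x n| - u)⁺ + u := sub_le_iff_le_add.1 (le_posPart _)
  have h2 := apply_apply_mono_left hβ h1 (abs_nonneg (y n))
  rw [map_add, add_apply] at h2
  linarith [abs_apply_apply_le hβ (x n) (y n), hu _ ⟨n, rfl⟩ _ ⟨n, rfl⟩, hN n hn]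

theorem isNullOnDisjointSeqs_iff (hβ : ∀ x y, 0 ≤ x → 0 ≤ y → 0 ≤ β x y) :
    IsNullOnDisjointSeqs β ↔
      ∀ (A : Set X) (B : Set Y), IsRelWeaklyCompact A → IsRelWeaklyCompact B →
        ∀ ε : ℝ, 0 < ε → ∃ u : X, 0 ≤ u ∧ ∀ x ∈ A, ∀ y ∈ B, β (|x| - u)⁺ |y| ≤ ε :=
  ⟨fun h _ _ hA hB _ hε => h.exists_forall_apply_posPart_sub_le hβ hA hB hε,
    isNullOnDisjointSeqs_of_forall_exists hβ⟩

end BilinearForm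

/-! ### The equivalence for positive operators -/

theorem corollary2p6 {E F : Type*}
    [NormedAddCommGroup E] [NormedSpace ℝ E] [Lattice E] [HasSolidNorm E]
    [IsOrderedAddMonoid E] [IsOrderedModule ℝ E] [CompleteSpace E]
    [NormedAddCommGroup F] [NormedSpace ℝ F] [Lattice F] [HasSolidNorm F]
    [IsOrderedAddMonoid F] [IsOrderedModule ℝ F] [CompleteSpace F]
    (T : E →L[ℝ] F) (hT : ∀ x : E, 0 ≤ x → 0 ≤ T x) :
    List.TFAE [
      IsAlmostWeakDunfordPettis T,
      ∀ (A : Set E) (B : Set (StrongDual ℝ F)), IsRelWeaklyCompact A → IsRelWeaklyCompact B →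
        ∀ ε : ℝ, 0 < ε → ∃ u : E, 0 ≤ u ∧
          ∀ x ∈ A, ∀ f ∈ B, |f| (T (|x| - u)⁺) ≤ ε,
      ∀ (A : Set E) (B : Set (StrongDual ℝ F)), IsRelWeaklyCompact A → IsRelWeaklyCompact B →
        ∀ ε : ℝ, 0 < ε → ∃ g : StrongDual ℝ F, 0 ≤ g ∧
          ∀ x ∈ A, ∀ f ∈ B, (|f| - g)⁺ (T |x|) ≤ ε] := by
  -- `γ f = f ∘ T`, so `γ.flip` on `E × F'` yields assertion 2 and `γ` on `F' × E` yields assertion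
  -- 3.
  let γ : StrongDual ℝ F →L[ℝ] StrongDual ℝ E := (ContinuousLinearMap.compL ℝ E F ℝ).flip T
  have hγ : ∀ (f : StrongDual ℝ F) (x : E), 0 ≤ f → 0 ≤ x → 0 ≤ γ f x := fun f x hf hx =>
    hf (T x) (hT x hx)
  have h2 := isNullOnDisjointSeqs_iff (β := γ.flip) fun x f hx hf => hγ f x hf hx
  have h3 := isNullOnDisjointSeqs_iff hγ
  tfae_have 1 ↔ 2 := h2
  tfae_have 1 ↔ 3 :=
    ⟨fun h A B hA hB ε hε => by
      obtain ⟨g, hg0, hg⟩ := h3.1 (fun f x hf hfd hx hxd => h x f hx hxd hf hfd) B A hB hA ε hε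
      exact ⟨g, hg0, fun x hx f hf => hg f hf x hx⟩,
    fun h x f hx hxd hf hfd => h3.2 (fun B A hB hA ε hε => by
      obtain ⟨g, hg0, hg⟩ := h A B hA hB ε hε
      exact ⟨g, hg0, fun f hf x hx => hg x hx f hf⟩) f x hf hfd hx hxd⟩
  tfae_finish
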